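/- Consider the control system $\dot x=f(x)+g(x)u$ with $x\in\mathbb R^n$, $u\in\mathbb R^m$ and $f,g$ (locally) Lipschitz, with state-dependent polytopes $$\Phi(x)=\{c\in\mathbb R^l: a_j(x)^\top c\le b_j(x),\ 1\le j\le N\},\qquad \Psi(x)=\{u\in\mathbb R^m:\mathfrak a_i(x)^\top u\le \mathfrak b_i(x),\ 1\le i\le K\},$$ where $N\ge 1$, all of $a_j,b_j,\mathfrak a_i,\mathfrak b_i$ are continuously differentiable in $x\in\mathbb R^n$, $\Psi(x)$ is never empty, the vectors $a_j(x)$ are never zero, and there is a compact set containing $\Phi(x)$ for all $x$. Fix $\epsilon_0>0$ and let $\mathcal A=\{x:\operatorname{Int}\Phi(x)\neq\emptyset\}$. For $z=(c,r)\in\mathbb R^{l}\times\mathbb R$ put $q=(0,-1)$, $\tilde a_1(x)=(0,-1)$, $\tilde b_1(x)=0$, $\tilde a_{j+1}(x)=(a_j(x),\|a_j(x)\|)$, $\tilde b_{j+1}(x)=b_j(x)$ for $1\le j\le N$, and $$F_P(x)=\{z:\tilde a_j(x)^\top z\le\tilde b_j(x),\ 1\le j\le N+1\},\quad S(x)=\operatorname*{argmin}_{z\in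 F_P(x)}q^\top z,\quad h_r(x)=-\epsilon_0-\min_{z\in F_P(x)}q^\top z\quad(x\in\mathcal A),$$ and $\mathcal S=\{x\in\mathcal A:h_r(x)\ge0\}$. With $\mathcal J_0(z,x)=\{j:\tilde a_j(x)^\top z=\tilde b_j(x)\}$ let $$M(z,x)=\Big\{\mu\in\mathbb R^{\mathcal J_0(z,x)}:\mu\ge0,\ \sum_{j\in\mathcal J_0(z,x)}\mu_j\tilde a_j(x)=-q\Big\},\qquad \partial_xL(\mu,z,x)=\sum_{j\in\mathcal J_0(z,x)}\mu_j\Big(z^\top\frac{\partial\tilde a_j}{\partial x}(x)-\frac{\partial\tilde b_j}{\partial x}(x)\Big).$$ Let $z^*(x)$ be any point chosen from $S(x)$, for each $x\in\mathcal A$. Suppose that there exist constants $\alpha,\bar\epsilon>0$ such that for every $x\in\mathcal A$ with $h_r(x)\ge-\bar\epsilon$ there is $u\in\Psi(x)$ with $$\min_{\mu\in M(z^*(x),x)}-\partial_xL(\mu,z^*(x),x)\,(f(x)+g(x)u)\ \ge\ -\alpha\,h_r(x).$$ Then $h_r$ is locally Lipschitz on $\mathcal A$ and has a finite one-sided directional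 derivative $h_r'(x;d)$ at every $x\in\mathcal A$ in every direction $d$, the set $\mathcal S$ is closed with $h_r=0$ on $\partial\mathcal S$, and $h_r$ satisfies the nonsmooth control barrier function condition on $\mathcal S$: there are a continuous, strictly increasing $\kappa:\mathbb R\to\mathbb R$ with $\kappa(0)=0$ and an open set $D$ with $\mathcal S\subseteq D\subseteq\mathcal A$ such that $$\sup_{u\in\Psi(x)}h_r'(x;f(x)+g(x)u)\ \ge\ -\kappa(h_r(x))\qquad\text{for all }x\in D.$$ Consequently, whenever $\mathcal S$ is nonempty without isolated points and $h_r>0$ on $\operatorname{Int}\mathcal S$ (so that $h_r$ is a nonsmooth barrier function candidate on $\mathcal S$: locally Lipschitz, zero on $\partial\mathcal S$, positive on $\operatorname{Int}\mathcal S$ and negative on $\mathcal A\setminus\mathcal S$), $h_r$ is a nonsmooth control barrier function on $\mathcal S$, that is, such a candidate which is directionally differentiable and satisfies the condition above. -/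

import Mathlib

open Set Filter Topology

noncomputable section

namespace PVM

/-! ### Nonsmooth control barrier functions -/

section Barrier

variable {X U : Type*} [NormedAddCommGroup X] [NormedSpace ℝ X]

/-- `h` has the (finite, one-sided) directional derivative `L` at `x` along `d`:
`(h (x + σ d) - h x) / σ → L` as `σ → 0⁺`. -/
def HasDirDerivAt (h : X → ℝ) (L : ℝ) (x d : X) : Prop :=
  Tendsto (fun σ : ℝ => (h (x + σ • d) - h x) / σ) (𝓝[>] 0) (𝓝 L)

/-- The directional derivative `h'(x; d)` (meaningful when the limit exists). -/
def dirDeriv (h : X → ℝ) (x d : X) : ℝ :=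
  limUnder (𝓝[>] (0 : ℝ)) (fun σ : ℝ => (h (x + σ • d) - h x) / σ)

/-- `h` has a finite directional derivative at every point of `A` along every direction. -/
def DirDifferentiableOn (h : X → ℝ) (A : Set X) : Prop :=
  ∀ x ∈ A, ∀ d : X, ∃ L : ℝ, HasDirDerivAt h L x d

/-- Extended class-`𝒦` functions. -/
structure IsExtendedClassK (α : ℝ → ℝ) : Prop where
  continuous : Continuous α
  strictMono : StrictMono α
  map_zero : α 0 = 0

/-- `h`, a function with domain `A`, is a nonsmooth barrier function candidate on `C`. The values of
`h` outside `A` play no role; for `A = univ` this is the definition for functions on the whole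
space. -/
structure IsNBFCandidate (A : Set X) (h : X → ℝ) (C : Set X) : Prop where
  nonempty : C.Nonempty
  isClosed : IsClosed C
  no_isolated : Preperfect C
  subset : C ⊆ A
  locallyLipschitz : LocallyLipschitzOn A h
  zero_of_frontier : ∀ x ∈ frontier C, h x = 0
  pos_of_interior : ∀ x ∈ interior C, 0 < h x
  neg_of_notMem : ∀ x ∈ A \ C, h x < 0

/-- The NCBF condition for the control system `ẋ = F x u`, with state-dependent set `Ψ x` of
admissible inputs: for some extended class-`𝒦` function `α` and some open set `D` with
`C ⊆ D ⊆ A`, we have `sup_{u ∈ Ψ x} h'(x; F x u) ≥ - α (h x)` for all `x ∈ D`. The supremum is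
taken in the extended reals, since it may be `+∞` when `Ψ x` is unbounded. -/
def NCBFCondition (F : X → U → X) (Ψ : X → Set U) (A : Set X) (h : X → ℝ) (C : Set X) : Prop :=
  ∃ α : ℝ → ℝ, IsExtendedClassK α ∧ ∃ D : Set X, IsOpen D ∧ C ⊆ D ∧ D ⊆ A ∧
    ∀ x ∈ D, ((-α (h x) : ℝ) : EReal) ≤ ⨆ u ∈ Ψ x, ((dirDeriv h x (F x u) : ℝ) : EReal)

/-- `h`, a function with domain `A`, is a nonsmooth control barrier function on `C` for the control
system `ẋ = F x u`, `u ∈ Ψ x`. -/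
structure IsNCBF (F : X → U → X) (Ψ : X → Set U) (A : Set X) (h : X → ℝ) (C : Set X) : Prop where
  candidate : IsNBFCandidate A h C
  dirDifferentiable : DirDifferentiableOn h A
  condition : NCBFCondition F Ψ A h C

end Barrier

/-! ### The parametric linear program -/

section Program

variable {n l N : ℕ}

/-- The state-dependent polytope `{c | a_jᵀ(x) c ≤ b_j(x) for all j}`. -/
def polytope {ι : Type*} (a : ι → EuclideanSpace ℝ (Fin n) → EuclideanSpace ℝ (Fin l))
    (b : ι → EuclideanSpace ℝ (Fin n) → ℝ) (x : EuclideanSpace ℝ (Fin n)) :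
    Set (EuclideanSpace ℝ (Fin l)) :=
  {c | ∀ j, inner ℝ (a j x) c ≤ b j x}

/-- `𝒜 = {x | Int Φ(x) ≠ ∅}`. -/
def regularSet (a : Fin N → EuclideanSpace ℝ (Fin n) → EuclideanSpace ℝ (Fin l))
    (b : Fin N → EuclideanSpace ℝ (Fin n) → ℝ) : Set (EuclideanSpace ℝ (Fin n)) :=
  {x | (interior (polytope a b x)).Nonempty}

/-- The space `ℝ^l × ℝ` (that is, `ℝ^{l+1}`) of the decision variable `z = col(c, r)`. -/
abbrev DecVar (l : ℕ) : Type := EuclideanSpace ℝ (Fin l) × ℝ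

/-- The dot product `pᵀ z` in `ℝ^{l+1}`. -/
def dot (p z : DecVar l) : ℝ := inner ℝ p.1 z.1 + p.2 * z.2

/-- The cost vector `q = col(0, -1)`. -/
def q : DecVar l := (0, -1)

/-- The rows `ã_j(x)` of the constraint matrix: the first one is `(0, -1)` (that is, `r ≥ 0`), the
others are `(a_j(x), ‖a_j(x)‖)`. -/
def aTilde (a : Fin N → EuclideanSpace ℝ (Fin n) → EuclideanSpace ℝ (Fin l))
    (j : Fin (N + 1)) (x : EuclideanSpace ℝ (Fin n)) : DecVar l :=
  Fin.cases (0, -1) (fun i => (a i x, ‖a i x‖)) j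

/-- The entries `b̃_j(x)` of the right-hand side: `0` followed by the `b_j(x)`. -/
def bTilde (b : Fin N → EuclideanSpace ℝ (Fin n) → ℝ)
    (j : Fin (N + 1)) (x : EuclideanSpace ℝ (Fin n)) : ℝ :=
  Fin.cases 0 (fun i => b i x) j

variable (a : Fin N → EuclideanSpace ℝ (Fin n) → EuclideanSpace ℝ (Fin l))
  (b : Fin N → EuclideanSpace ℝ (Fin n) → ℝ)

/-- The feasible set `F_P(x)`. -/
def feasible (x : EuclideanSpace ℝ (Fin n)) : Set (DecVar l) :=
  {z | ∀ j, dot (aTilde a j x) z ≤ bTilde b j x}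

/-- `h_r(x) = - ε₀ - min_{z ∈ F_P(x)} qᵀ z`, to be used for `x ∈ 𝒜`. -/
def hr (ε₀ : ℝ) (x : EuclideanSpace ℝ (Fin n)) : ℝ :=
  -ε₀ - sInf ((fun z => dot q z) '' feasible a b x)

/-- The superlevel set `{x ∈ 𝒜 | h_r(x) ≥ c}`. -/
def superlevel (ε₀ c : ℝ) : Set (EuclideanSpace ℝ (Fin n)) :=
  {x | x ∈ regularSet a b ∧ c ≤ hr a b ε₀ x}

/-- The solution map `S(x) = argmin_{z ∈ F_P(x)} qᵀ z`. -/
def solutions (x : EuclideanSpace ℝ (Fin n)) : Set (DecVar l) :=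
  {z | z ∈ feasible a b x ∧ ∀ w ∈ feasible a b x, dot q z ≤ dot q w}

open Classical in
/-- The active index set `𝒥₀(z, x)`. -/
def active (z : DecVar l) (x : EuclideanSpace ℝ (Fin n)) : Finset (Fin (N + 1)) :=
  Finset.univ.filter (fun j => dot (aTilde a j x) z = bTilde b j x)

/-- The multiplier set `M(z, x) = {μ ≥ 0 | Σ_{j ∈ 𝒥₀(z,x)} μ_j ã_j(x) = - q}`, whose elements are
vectors indexed by the active index set. -/
def multipliers (z : DecVar l) (x : EuclideanSpace ℝ (Fin n)) : Set (active a b z x → ℝ) :=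
  {μ | (∀ j, 0 ≤ μ j) ∧ ∑ j, μ j • aTilde a (j : Fin (N + 1)) x = -q}

/-- `∂ₓL(μ, z, x) d = Σ_{j ∈ 𝒥₀(z,x)} μ_j (zᵀ (∂ã_j/∂x)(x) d - (∂b̃_j/∂x)(x) d)`. -/
def dxL (z : DecVar l) (x : EuclideanSpace ℝ (Fin n)) (μ : active a b z x → ℝ)
    (d : EuclideanSpace ℝ (Fin n)) : ℝ :=
  ∑ j, μ j * (dot z (fderiv ℝ (aTilde a (j : Fin (N + 1))) x d)
    - fderiv ℝ (bTilde b (j : Fin (N + 1))) x d)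

end Program

end PVM

end

/-! Up to the shift `ε₀`, `hr` is the largest radius `r` of a ball inscribed in the polytope, the
value of a linear program that is strictly feasible exactly on `regularSet`.

Linearising the active constraints at a solution `z` along `d` gives a linear program in a direction
`w`. A strictly feasible `w` yields feasible points `z + σ • w` at `x + σ • d`, so the difference
quotients of `hr` are eventually at least `w.2` (`eventually_le_slope_hr`). Conversely, quotients
that exceed `t` arbitrarily close to `0` produce, for each `s < t`, such a `w` with `s < w.2` at a
limit of solutions (`exists_direction_of_frequently`). Hence the quotients cannot oscillate and the
directional derivative exists.

The dual of the linearised program is the minimum of `-dxL` over the multipliers. By duality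
(`exists_strict_direction`), a lower bound on it at any one solution bounds the derivative from
below; no formula for the derivative is needed, which is why the selection `zs` may be arbitrary.
The barrier condition follows with `κ(r) = α r`. -/

namespace PVM

/-! ### Linear programming duality by separation. -/

section Alternative

/-- Gordan's alternative for a finite family of vectors. -/
theorem exists_forall_neg_of_forall_stdSimplex {ι V : Type*} [Fintype ι] [NormedAddCommGroup V]
    [NormedSpace ℝ V] (s : ι → V) (h : ∀ c ∈ stdSimplex ℝ ι, ∑ i, c i • s i ≠ 0) :
    ∃ φ : V →L[ℝ] ℝ, ∀ i, φ (s i) < 0 := by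
  classical
  let T : (ι → ℝ) →ₗ[ℝ] V := Fintype.linearCombination ℝ s
  have hT : ∀ c, T c = ∑ i, c i • s i := fun c => Fintype.linearCombination_apply ℝ s c
  have hTc : Continuous T := by
    have : (T : (ι → ℝ) → V) = fun c => ∑ i, c i • s i := funext hT
    rw [this]
    fun_prop
  have hconv : Convex ℝ (T '' stdSimplex ℝ ι) := (convex_stdSimplex ℝ ι).linear_image T
  have hcl : IsClosed (T '' stdSimplex ℝ ι) := ((isCompact_stdSimplex ℝ ι).image hTc).isClosed
  have h0 : (0 : V) ∉ T '' stdSimplex ℝ ι := by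
    rintro ⟨c, hc, hc0⟩
    exact h c hc ((hT c).symm.trans hc0)
  obtain ⟨φ, u, hφ, hu⟩ := geometric_hahn_banach_closed_point hconv hcl h0
  refine ⟨φ, fun i => ?_⟩
  have hmem : s i ∈ T '' stdSimplex ℝ ι :=
    ⟨Pi.single i 1, single_mem_stdSimplex ℝ i, by simp [T]⟩
  rw [map_zero] at hu
  exact (hφ _ hmem).trans hu

variable {l : ℕ}

theorem dot_q (z : DecVar l) : dot q z = -z.2 := by simp [dot, q]

theorem dot_comm (p z : DecVar l) : dot p z = dot z p := by
  simp only [dot, real_inner_comm, mul_comm]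

theorem dot_add (p z w : DecVar l) : dot p (z + w) = dot p z + dot p w := by
  simp only [dot, Prod.fst_add, Prod.snd_add, inner_add_right]; ring

theorem dot_sub (p z w : DecVar l) : dot p (z - w) = dot p z - dot p w := by
  simp only [dot, Prod.fst_sub, Prod.snd_sub, inner_sub_right]; ring

theorem dot_smul (t : ℝ) (p z : DecVar l) : dot p (t • z) = t * dot p z := by
  simp only [dot, Prod.smul_fst, Prod.smul_snd, inner_smul_right, smul_eq_mul]; ring

theorem dot_sum {J : Type*} (s : Finset J) (p : DecVar l) (z : J → DecVar l) :
    dot p (∑ j ∈ s, z j) = ∑ j ∈ s, dot p (z j) := by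
  classical
  induction s using Finset.induction_on with
  | empty => simp [dot]
  | insert i s hi ih => rw [Finset.sum_insert hi, Finset.sum_insert hi, dot_add, ih]

theorem continuous_dot : Continuous fun p : DecVar l × DecVar l => dot p.1 p.2 := by
  unfold dot
  fun_prop

theorem tendsto_dot {ι : Type*} {F : Filter ι} {p z : ι → DecVar l} {p₀ z₀ : DecVar l}
    (hp : Tendsto p F (𝓝 p₀)) (hz : Tendsto z F (𝓝 z₀)) :
    Tendsto (fun k => dot (p k) (z k)) F (𝓝 (dot p₀ z₀)) :=
  (hp.fst_nhds.inner hz.fst_nhds).add (hp.snd_nhds.mul hz.snd_nhds)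

theorem hasDerivAt_dot {p z : ℝ → DecVar l} {p' z' : DecVar l} {t : ℝ}
    (hp : HasDerivAt p p' t) (hz : HasDerivAt z z' t) :
    HasDerivAt (fun s => dot (p s) (z s)) (dot (p t) z' + dot (z t) p') t := by
  have h1 := (HasDerivAt.inner ℝ (hasFDerivAt_fst.comp_hasDerivAt t hp)
    (hasFDerivAt_fst.comp_hasDerivAt t hz)).add
    ((hasFDerivAt_snd.comp_hasDerivAt t hp).mul (hasFDerivAt_snd.comp_hasDerivAt t hz))
  refine h1.congr_deriv ?_
  simp only [dot, ContinuousLinearMap.coe_fst', ContinuousLinearMap.coe_snd', Function.comp,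
    real_inner_comm]
  ring

/-- The product carries the sup norm, so the Riesz representation is applied to the first factor
only. -/
theorem exists_dot_eq (φ : DecVar l →L[ℝ] ℝ) : ∃ w : DecVar l, ∀ p, φ p = dot p w := by
  let φ₁ : EuclideanSpace ℝ (Fin l) →L[ℝ] ℝ :=
    φ.comp (ContinuousLinearMap.inl ℝ (EuclideanSpace ℝ (Fin l)) ℝ)
  refine ⟨((InnerProductSpace.toDual ℝ _).symm φ₁, φ (0, 1)), fun p => ?_⟩
  have h1 : p = (p.1, 0) + p.2 • ((0 : EuclideanSpace ℝ (Fin l)), (1 : ℝ)) := by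
    ext <;> simp
  have h2 : inner ℝ p.1 ((InnerProductSpace.toDual ℝ _).symm φ₁) = φ (p.1, 0) := by
    rw [real_inner_comm, InnerProductSpace.toDual_symm_apply]
    rfl
  conv_lhs => rw [h1]
  rw [map_add, map_smul, dot, h2, smul_eq_mul]

/-- Duality for a strictly feasible linear program, in terms of a lower bound on its dual. -/
theorem exists_strict_direction {J : Type*} [Fintype J] (A : J → DecVar l) (β : J → ℝ)
    {v : DecVar l} (hv : ∀ j, dot (A j) v < 0) {L L' : ℝ} (hL : L' < L)
    (hμ : ∀ μ : J → ℝ, (∀ j, 0 ≤ μ j) → ∑ j, μ j • A j = -q → L ≤ ∑ j, μ j * β j) :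
    ∃ w : DecVar l, (∀ j, dot (A j) w < β j) ∧ L' < w.2 := by
  -- A functional negative on this family is `(w, t)`: the first vector forces `t > 0`, and after
  -- division by `t` the others give the objective bound and the constraints.
  let s : Option (Option J) → DecVar l × ℝ := fun o =>
    o.elim (0, -1) fun o' => o'.elim (q, L') fun j => (A j, -β j)
  have hs : ∀ c ∈ stdSimplex ℝ (Option (Option J)), ∑ i, c i • s i ≠ 0 := by
    rintro c ⟨hc0, hc1⟩ hsum
    simp only [Fintype.sum_option] at hsum hc1
    have hfst := congrArg Prod.fst hsum
    have hsnd := congrArg Prod.snd hsum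
    simp only [s, Option.elim, Prod.fst_add, Prod.fst_sum, Prod.smul_fst, smul_zero, zero_add,
      Prod.fst_zero] at hfst
    simp only [s, Option.elim, Prod.snd_add, Prod.snd_sum, Prod.smul_snd, smul_eq_mul,
      Prod.snd_zero, mul_neg, mul_one, Finset.sum_neg_distrib] at hsnd
    -- If `q` has weight zero, pairing with `v` kills all constraint weights, leaving only `(0,
    -- -1)`. Otherwise dividing by the weight of `q` gives a multiplier that violates `hμ`.
    rcases (hc0 (some none)).eq_or_lt with hlam | hlam
    · rw [← hlam, zero_smul, zero_add] at hfst
      have h1 : ∑ j, c (some (some j)) * dot (A j) v = 0 := by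
        have := congrArg (dot v) hfst
        simp only [dot_sum, dot_smul] at this
        simp only [dot_comm _ v, this]
        simp [dot]
      have h2 : ∀ j, c (some (some j)) = 0 := fun j => by
        have h3 := (Finset.sum_eq_zero_iff_of_nonpos fun j _ =>
          mul_nonpos_of_nonneg_of_nonpos (hc0 (some (some j))) (hv j).le).1 h1 j
            (Finset.mem_univ j)
        exact (mul_eq_zero.1 h3).resolve_right (hv j).ne
      simp only [h2, ← hlam, zero_mul, Finset.sum_const_zero] at hsnd hc1
      linarith
    · set t := c (some none) with ht
      have h1 := hμ (fun j => t⁻¹ * c (some (some j)))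
        (fun j => mul_nonneg (inv_nonneg.2 hlam.le) (hc0 _)) (by
          simp only [mul_smul, ← Finset.smul_sum]
          rw [eq_neg_of_add_eq_zero_right hfst, smul_neg, smul_smul, inv_mul_cancel₀ hlam.ne',
            one_smul])
      simp only [mul_assoc, ← Finset.mul_sum] at h1
      have h2 : t * L ≤ ∑ j, c (some (some j)) * β j := by
        rwa [← le_inv_mul_iff₀ hlam]
      have h3 := hc0 none
      nlinarith [mul_lt_mul_of_pos_left hL hlam]
  obtain ⟨φ, hφ⟩ := exists_forall_neg_of_forall_stdSimplex s hs
  obtain ⟨w, hw⟩ := exists_dot_eq (φ.comp (ContinuousLinearMap.inl ℝ (DecVar l) ℝ))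
  set t := φ (0, 1) with ht
  have hdec : ∀ (p : DecVar l) (r : ℝ), φ (p, r) = dot p w + r * t := fun p r => by
    rw [← hw p]
    have : (p, r) = (p, (0 : ℝ)) + r • ((0 : DecVar l), (1 : ℝ)) := by
      ext <;> simp
    rw [this, map_add, map_smul, smul_eq_mul]
    rfl
  have htpos : 0 < t := by
    have := hφ none
    simp only [s, Option.elim, hdec] at this
    simp [dot] at this
    linarith
  refine ⟨t⁻¹ • w, fun j => ?_, ?_⟩
  · have := hφ (some (some j))
    simp only [s, Option.elim, hdec] at this
    rw [dot_smul, inv_mul_lt_iff₀ htpos]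
    linarith
  · have := hφ (some none)
    simp only [s, Option.elim, hdec, dot_q] at this
    rw [Prod.smul_snd, smul_eq_mul, lt_inv_mul_iff₀ htpos]
    linarith

end Alternative

/-! ### Feasibility and Lipschitz continuity of the value. -/

section Value

variable {n l N : ℕ} {a : Fin N → EuclideanSpace ℝ (Fin n) → EuclideanSpace ℝ (Fin l)}
  {b : Fin N → EuclideanSpace ℝ (Fin n) → ℝ}

theorem mem_feasible_iff {x : EuclideanSpace ℝ (Fin n)} {z : DecVar l} :
    z ∈ feasible a b x ↔
      0 ≤ z.2 ∧ ∀ i, inner ℝ (a i x) z.1 + ‖a i x‖ * z.2 ≤ b i x := by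
  simp [feasible, Fin.forall_fin_succ, aTilde, bTilde, dot]

theorem contDiff_aTilde (ha : ∀ j, ContDiff ℝ 1 (a j)) (ha0 : ∀ j x, a j x ≠ 0)
    (j : Fin (N + 1)) : ContDiff ℝ 1 (aTilde a j) := by
  refine Fin.cases ?_ (fun i => ?_) j
  · exact contDiff_const
  · exact (ha i).prodMk ((ha i).norm ℝ (ha0 i))

theorem contDiff_bTilde (hb : ∀ j, ContDiff ℝ 1 (b j)) (j : Fin (N + 1)) :
    ContDiff ℝ 1 (bTilde b j) := by
  refine Fin.cases ?_ (fun i => ?_) j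
  · exact contDiff_const
  · exact hb i

/-- The interior of the polytope is nonempty iff the linear program is strictly feasible. -/
theorem mem_regularSet_iff (ha0 : ∀ j x, a j x ≠ 0) {x : EuclideanSpace ℝ (Fin n)} :
    x ∈ regularSet a b ↔ ∃ z : DecVar l, ∀ j, dot (aTilde a j x) z < bTilde b j x := by
  have hiff : ∀ z : DecVar l, (∀ j, dot (aTilde a j x) z < bTilde b j x) ↔
      0 < z.2 ∧ ∀ i, inner ℝ (a i x) z.1 + ‖a i x‖ * z.2 < b i x := fun z => by
    simp [Fin.forall_fin_succ, aTilde, bTilde, dot]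
  simp only [hiff]
  constructor
  · rintro ⟨c, hc⟩
    obtain ⟨e, he, hball⟩ := Metric.mem_nhds_iff.1 (mem_interior_iff_mem_nhds.1 hc)
    refine ⟨(c, e / 3), by positivity, fun i => ?_⟩
    have hpos : 0 < ‖a i x‖ := norm_pos_iff.2 (ha0 i x)
    have hmem : c + (e / 2 / ‖a i x‖) • a i x ∈ Metric.ball c e := by
      rw [mem_ball_iff_norm, add_sub_cancel_left, norm_smul, Real.norm_of_nonneg (by positivity),
        div_mul_cancel₀ _ hpos.ne']
      linarith
    have h1 := hball hmem i
    rw [inner_add_right, inner_smul_right, real_inner_self_eq_norm_sq] at h1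
    have h2 : e / 2 / ‖a i x‖ * ‖a i x‖ ^ 2 = ‖a i x‖ * (e / 2) := by
      field_simp
    have h3 : ‖a i x‖ * (e / 3) < ‖a i x‖ * (e / 2) := by
      gcongr; norm_num
    simp only
    linarith
  · rintro ⟨z, hz, h⟩
    refine ⟨z.1, mem_interior_iff_mem_nhds.2 <| Filter.mem_of_superset
      (Metric.ball_mem_nhds z.1 hz) fun y hy i => ?_⟩
    have h1 : inner ℝ (a i x) (y - z.1) ≤ ‖a i x‖ * ‖y - z.1‖ := real_inner_le_norm _ _
    have h2 : ‖a i x‖ * ‖y - z.1‖ ≤ ‖a i x‖ * z.2 := by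
      gcongr
      exact (mem_ball_iff_norm.1 hy).le
    rw [inner_sub_right] at h1
    linarith [h i]

theorem isOpen_regularSet (ha : ∀ j, ContDiff ℝ 1 (a j)) (hb : ∀ j, ContDiff ℝ 1 (b j))
    (ha0 : ∀ j x, a j x ≠ 0) : IsOpen (regularSet a b) := by
  have : regularSet a b =
      ⋃ z : DecVar l, ⋂ j, {x | dot (aTilde a j x) z < bTilde b j x} := by
    ext x
    simp [mem_regularSet_iff ha0]
  rw [this]
  refine isOpen_iUnion fun z => isOpen_iInter_of_finite fun j => isOpen_lt ?_ ?_
  · exact continuous_dot.comp ((contDiff_aTilde ha ha0 j).continuous.prodMk continuous_const)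
  · exact (contDiff_bTilde hb j).continuous

theorem mem_regularSet_of_mem_feasible (ha0 : ∀ j x, a j x ≠ 0)
    {x : EuclideanSpace ℝ (Fin n)} {z : DecVar l} (hz : z ∈ feasible a b x) (hpos : 0 < z.2) :
    x ∈ regularSet a b := by
  rw [mem_regularSet_iff ha0]
  refine ⟨(z.1, z.2 / 2), Fin.cases ?_ fun i => ?_⟩
  · simp [dot, aTilde, bTilde, hpos]
  · have h1 := (mem_feasible_iff.1 hz).2 i
    have h2 : ‖a i x‖ * (z.2 / 2) < ‖a i x‖ * z.2 := by
      have := norm_pos_iff.2 (ha0 i x)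
      gcongr
      linarith
    simp only [dot, aTilde, bTilde, Fin.cases_succ]
    linarith

/-- Both the centre and the centre moved by `z.2` along a unit vector lie in the polytope, which
bounds the radius too. -/
theorem isBounded_iUnion_feasible (hN : 0 < N) (ha0 : ∀ j x, a j x ≠ 0)
    (hΦ : ∃ Dy : Set (EuclideanSpace ℝ (Fin l)), IsCompact Dy ∧ ∀ x, polytope a b x ⊆ Dy) :
    ∃ R : ℝ, 0 ≤ R ∧ ∀ x, ∀ z ∈ feasible a b x, ‖z‖ ≤ R := by
  obtain ⟨Dy, hDy, hsub⟩ := hΦ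
  obtain ⟨R, hRpos, hR⟩ := hDy.isBounded.exists_pos_norm_le
  refine ⟨2 * R, by positivity, fun x z hz => ?_⟩
  obtain ⟨hz2, hz⟩ := mem_feasible_iff.1 hz
  let v := ‖a ⟨0, hN⟩ x‖⁻¹ • a ⟨0, hN⟩ x
  have hv : ‖v‖ = 1 := norm_smul_inv_norm (𝕜 := ℝ) (ha0 ⟨0, hN⟩ x)
  have h1 : ‖z.1‖ ≤ R := hR _ <| hsub x fun i => by
    have := mul_nonneg (norm_nonneg (a i x)) hz2
    linarith [hz i]
  have h2 : ‖z.1 + z.2 • v‖ ≤ R := hR _ <| hsub x fun i => by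
    rw [inner_add_right, inner_smul_right]
    have h3 : inner ℝ (a i x) v ≤ ‖a i x‖ := by
      simpa [hv] using real_inner_le_norm (a i x) v
    nlinarith [hz i]
  have h3 : ‖z.2 • v‖ ≤ ‖z.1 + z.2 • v‖ + ‖z.1‖ := by
    simpa using norm_sub_le (z.1 + z.2 • v) z.1
  rw [norm_smul, hv, mul_one] at h3
  rw [Prod.norm_def]
  exact max_le (by linarith) (by linarith)

theorem hr_eq_of_mem_solutions {ε₀ : ℝ} {x : EuclideanSpace ℝ (Fin n)} {z : DecVar l}
    (hz : z ∈ solutions a b x) : hr a b ε₀ x = z.2 - ε₀ := by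
  have : IsLeast ((fun z => dot q z) '' feasible a b x) (dot q z) :=
    ⟨⟨z, hz.1, rfl⟩, by rintro _ ⟨w, hw, rfl⟩; exact hz.2 w hw⟩
  rw [hr, this.csInf_eq, dot_q]
  ring

theorem snd_le_of_mem_solutions {x : EuclideanSpace ℝ (Fin n)} {z w : DecVar l}
    (hz : z ∈ solutions a b x) (hw : w ∈ feasible a b x) : w.2 ≤ z.2 := by
  have := hz.2 w hw
  simpa [dot_q] using this

theorem mem_feasible_of_tendsto (ha : ∀ j, ContDiff ℝ 1 (a j)) (hb : ∀ j, ContDiff ℝ 1 (b j))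
    (ha0 : ∀ j x, a j x ≠ 0) {ι : Type*} {F : Filter ι} [F.NeBot]
    {y : ι → EuclideanSpace ℝ (Fin n)} {ζ : ι → DecVar l} {x : EuclideanSpace ℝ (Fin n)}
    {z : DecVar l} (hy : Tendsto y F (𝓝 x)) (hζ : Tendsto ζ F (𝓝 z))
    (h : ∀ᶠ k in F, ζ k ∈ feasible a b (y k)) : z ∈ feasible a b x := fun j => by
  have h1 : Tendsto (fun k => dot (aTilde a j (y k)) (ζ k)) F (𝓝 (dot (aTilde a j x) z)) :=
    tendsto_dot (((contDiff_aTilde ha ha0 j).continuous.tendsto x).comp hy) hζ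
  have h2 : Tendsto (fun k => bTilde b j (y k)) F (𝓝 (bTilde b j x)) :=
    ((contDiff_bTilde hb j).continuous.tendsto x).comp hy
  exact le_of_tendsto_of_tendsto h1 h2 (h.mono fun k hk => hk j)

theorem locallyLipschitzOn_hr (hN : 0 < N) (ha : ∀ j, ContDiff ℝ 1 (a j))
    (hb : ∀ j, ContDiff ℝ 1 (b j)) (ha0 : ∀ j x, a j x ≠ 0)
    (hΦ : ∃ Dy : Set (EuclideanSpace ℝ (Fin l)), IsCompact Dy ∧ ∀ x, polytope a b x ⊆ Dy)
    (ε₀ : ℝ) {zs : EuclideanSpace ℝ (Fin n) → DecVar l}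
    (hzs : ∀ x ∈ regularSet a b, zs x ∈ solutions a b x) :
    LocallyLipschitzOn (regularSet a b) (hr a b ε₀) := by
  obtain ⟨R, hR0, hR⟩ := isBounded_iUnion_feasible hN ha0 hΦ
  -- With normalised rows the radius has coefficient `1`, so a perturbation of the data is absorbed
  -- by shrinking the radius.
  let G : EuclideanSpace ℝ (Fin n) → Fin N → DecVar l :=
    fun x j => (‖a j x‖⁻¹ • a j x, ‖a j x‖⁻¹ * b j x)
  have hG : ContDiff ℝ 1 G := contDiff_pi.2 fun j => by
    have hinv : ContDiff ℝ 1 fun x => ‖a j x‖⁻¹ :=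
      ((ha j).norm ℝ (ha0 j)).inv fun x => norm_ne_zero_iff.2 (ha0 j x)
    exact (hinv.smul (ha j)).prodMk (hinv.mul (hb j))
  have hfeas : ∀ x (z : DecVar l), z ∈ feasible a b x ↔
      0 ≤ z.2 ∧ ∀ j, z.2 ≤ (G x j).2 - inner ℝ (G x j).1 z.1 := fun x z => by
    rw [mem_feasible_iff]
    refine and_congr_right fun _ => forall_congr' fun j => ?_
    have hpos : 0 < ‖a j x‖ := norm_pos_iff.2 (ha0 j x)
    simp only [G, inner_smul_left, RCLike.conj_to_real]
    rw [← mul_sub, le_inv_mul_iff₀ hpos]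
    constructor <;> intro h <;> linarith
  intro x₀ hx₀
  obtain ⟨K, t, ht, hK⟩ := hG.locallyLipschitz x₀
  refine ⟨K * (1 + ⟨R, hR0⟩), t ∩ regularSet a b,
    inter_mem (mem_nhdsWithin_of_mem_nhds ht) self_mem_nhdsWithin, ?_⟩
  refine LipschitzOnWith.of_le_add_mul _ fun x hx y hy => ?_
  have hzx := hzs x hx.2
  have hzy := hzs y hy.2
  rw [hr_eq_of_mem_solutions hzx, hr_eq_of_mem_solutions hzy]
  have hy0 : 0 ≤ (zs y).2 := ((hfeas _ _).1 hzy.1).1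
  push_cast
  set δ := (K : ℝ) * (1 + R) * dist x y with hδ
  have hδ0 : 0 ≤ δ := by positivity
  suffices h : (zs x).2 ≤ (zs y).2 + δ by
    change _ ≤ _ + δ
    linarith
  -- A negative shrunken radius is infeasible, but then the bound follows from `hy0`.
  by_cases hcase : (zs x).2 - δ < 0
  · linarith
  have hmem : ((zs x).1, (zs x).2 - δ) ∈ feasible a b y := by
    refine (hfeas _ _).2 ⟨not_lt.1 hcase, fun j => ?_⟩
    have h1 := ((hfeas _ _).1 hzx.1).2 j
    have hd : dist (G x j) (G y j) ≤ K * dist x y :=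
      (dist_le_pi_dist (G x) (G y) j).trans (hK.dist_le_mul x hx.1 y hy.1)
    rw [Prod.dist_eq, max_le_iff, dist_eq_norm, Real.dist_eq] at hd
    have h2 := (abs_le.1 hd.2).2
    have hnz : ‖(zs x).1‖ ≤ R := (norm_fst_le _).trans (hR x _ hzx.1)
    have h3 : inner ℝ ((G y j).1 - (G x j).1) (zs x).1 ≤ K * dist x y * R := by
      refine (real_inner_le_norm _ _).trans ?_
      rw [norm_sub_rev]
      exact mul_le_mul hd.1 hnz (norm_nonneg _) (by positivity)
    rw [inner_sub_left] at h3
    simp only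
    rw [hδ]
    linarith
  linarith [snd_le_of_mem_solutions hzy hmem]

/-! ### Directional derivatives of the value. -/

theorem hasLineDerivAt_aTilde (ha : ∀ j, ContDiff ℝ 1 (a j)) (ha0 : ∀ j x, a j x ≠ 0)
    (j : Fin (N + 1)) (x d : EuclideanSpace ℝ (Fin n)) :
    HasLineDerivAt ℝ (aTilde a j) (fderiv ℝ (aTilde a j) x d) x d :=
  ((contDiff_aTilde ha ha0 j).differentiable one_ne_zero x).hasFDerivAt.hasLineDerivAt d

theorem hasLineDerivAt_bTilde (hb : ∀ j, ContDiff ℝ 1 (b j))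
    (j : Fin (N + 1)) (x d : EuclideanSpace ℝ (Fin n)) :
    HasLineDerivAt ℝ (bTilde b j) (fderiv ℝ (bTilde b j) x d) x d :=
  ((contDiff_bTilde hb j).differentiable one_ne_zero x).hasFDerivAt.hasLineDerivAt d

theorem mem_active_iff {z : DecVar l} {x : EuclideanSpace ℝ (Fin n)} {j : Fin (N + 1)} :
    j ∈ active a b z x ↔ dot (aTilde a j x) z = bTilde b j x := by
  simp [active]

variable (a b) in
/-- The right-hand side of the linearisation along `d` of the constraints at `(z, x)`. -/
noncomputable def linearizedRhs (z : DecVar l) (x d : EuclideanSpace ℝ (Fin n)) (j : Fin (N + 1)) : ℝ :=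
  fderiv ℝ (bTilde b j) x d - dot z (fderiv ℝ (aTilde a j) x d)

theorem neg_dxL_eq (z : DecVar l) (x d : EuclideanSpace ℝ (Fin n)) (μ : active a b z x → ℝ) :
    -dxL a b z x μ d = ∑ j, μ j * linearizedRhs a b z x d j := by
  rw [dxL, ← Finset.sum_neg_distrib]
  refine Finset.sum_congr rfl fun j _ => ?_
  rw [linearizedRhs]
  ring

theorem tendsto_add_smul_nhdsGT (x d : EuclideanSpace ℝ (Fin n)) :
    Tendsto (fun σ : ℝ => x + σ • d) (𝓝[>] 0) (𝓝 x) := by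
  have h : Continuous fun σ : ℝ => x + σ • d := by fun_prop
  have := (h.tendsto 0).mono_left (nhdsWithin_le_nhds (s := Ioi 0))
  simpa using this

/-- Strictly feasible directions of the linearised constraints stay feasible. -/
theorem eventually_add_smul_mem_feasible (ha : ∀ j, ContDiff ℝ 1 (a j))
    (hb : ∀ j, ContDiff ℝ 1 (b j)) (ha0 : ∀ j x, a j x ≠ 0) {x d : EuclideanSpace ℝ (Fin n)}
    {z w : DecVar l} (hz : z ∈ feasible a b x)
    (hw : ∀ j ∈ active a b z x, dot (aTilde a j x) w < linearizedRhs a b z x d j) :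
    ∀ᶠ σ : ℝ in 𝓝[>] 0, z + σ • w ∈ feasible a b (x + σ • d) := by
  refine eventually_all.2 fun j => ?_
  have hline : HasDerivAt (fun σ : ℝ => z + σ • w) w 0 := by
    simpa using ((hasDerivAt_id (0 : ℝ)).smul_const w).const_add z
  have hψ := (hasDerivAt_dot (hasLineDerivAt_aTilde ha ha0 j x d) hline).sub
    (hasLineDerivAt_bTilde hb j x d)
  simp only [zero_smul, add_zero] at hψ
  -- Active constraints have negative derivative along the path; inactive ones persist by
  -- continuity.
  by_cases hj : j ∈ active a b z x
  · have hneg : dot (aTilde a j x) w + dot z (fderiv ℝ (aTilde a j) x d)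
        - fderiv ℝ (bTilde b j) x d < 0 := by
      have := hw j hj
      rw [linearizedRhs] at this
      linarith
    filter_upwards [hψ.tendsto_slope_zero_right.eventually (gt_mem_nhds hneg),
      self_mem_nhdsWithin] with σ hσ hσ0
    simp only [zero_add, Pi.sub_apply, zero_smul, add_zero, mem_active_iff.1 hj, sub_self,
      sub_zero, smul_eq_mul] at hσ
    have := neg_of_mul_neg_right hσ (inv_nonneg.2 (le_of_lt hσ0))
    linarith
  · have hlt : dot (aTilde a j x) z - bTilde b j x < 0 :=
      sub_neg.2 (lt_of_le_of_ne (hz j) fun h => hj (mem_active_iff.2 h))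
    have hc := hψ.continuousAt.tendsto.mono_left (nhdsWithin_le_nhds (s := Ioi 0))
    simp only [Pi.sub_apply, zero_smul, add_zero] at hc
    filter_upwards [hc.eventually (gt_mem_nhds hlt)] with σ hσ
    exact (sub_neg.1 hσ).le

theorem eventually_le_slope_hr (ha : ∀ j, ContDiff ℝ 1 (a j)) (hb : ∀ j, ContDiff ℝ 1 (b j))
    (ha0 : ∀ j x, a j x ≠ 0) (ε₀ : ℝ) {zs : EuclideanSpace ℝ (Fin n) → DecVar l}
    (hzs : ∀ x ∈ regularSet a b, zs x ∈ solutions a b x) {x d : EuclideanSpace ℝ (Fin n)}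
    (hx : x ∈ regularSet a b) {z w : DecVar l} (hz : z ∈ solutions a b x)
    (hw : ∀ j ∈ active a b z x, dot (aTilde a j x) w < linearizedRhs a b z x d j) :
    ∀ᶠ σ : ℝ in 𝓝[>] 0, w.2 ≤ (hr a b ε₀ (x + σ • d) - hr a b ε₀ x) / σ := by
  filter_upwards [eventually_add_smul_mem_feasible ha hb ha0 hz.1 hw, self_mem_nhdsWithin,
    (tendsto_add_smul_nhdsGT x d).eventually ((isOpen_regularSet ha hb ha0).mem_nhds hx)]
    with σ hσ hσ0 hreg
  rw [hr_eq_of_mem_solutions (hzs _ hreg), hr_eq_of_mem_solutions hz, le_div_iff₀ hσ0]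
  have := snd_le_of_mem_solutions (hzs _ hreg) hσ
  simp only [Prod.snd_add, Prod.smul_snd, smul_eq_mul] at this
  linarith

theorem exists_inward_direction (ha0 : ∀ j x, a j x ≠ 0) {x : EuclideanSpace ℝ (Fin n)}
    (hx : x ∈ regularSet a b) (z : DecVar l) :
    ∃ v : DecVar l, ∀ j ∈ active a b z x, dot (aTilde a j x) v < 0 := by
  obtain ⟨z₀, hz₀⟩ := (mem_regularSet_iff ha0).1 hx
  refine ⟨z₀ - z, fun j hj => ?_⟩
  rw [dot_sub, mem_active_iff.1 hj]
  exact sub_neg.2 (hz₀ j)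

/-- A value of the difference quotients taken infinitely often is almost attained by a strict
direction of the linearised program at some solution. -/
theorem exists_direction_of_frequently (hN : 0 < N) (ha : ∀ j, ContDiff ℝ 1 (a j))
    (hb : ∀ j, ContDiff ℝ 1 (b j)) (ha0 : ∀ j x, a j x ≠ 0)
    (hΦ : ∃ Dy : Set (EuclideanSpace ℝ (Fin l)), IsCompact Dy ∧ ∀ x, polytope a b x ⊆ Dy)
    {ε₀ : ℝ} {zs : EuclideanSpace ℝ (Fin n) → DecVar l}
    (hzs : ∀ x ∈ regularSet a b, zs x ∈ solutions a b x) {x d : EuclideanSpace ℝ (Fin n)}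
    (hx : x ∈ regularSet a b) {s t : ℝ} (hst : s < t)
    (hfreq : ∃ᶠ σ : ℝ in 𝓝[>] 0, t < (hr a b ε₀ (x + σ • d) - hr a b ε₀ x) / σ) :
    ∃ z ∈ solutions a b x, ∃ w : DecVar l,
      (∀ j ∈ active a b z x, dot (aTilde a j x) w < linearizedRhs a b z x d j) ∧ s < w.2 := by
  obtain ⟨R, -, hR⟩ := isBounded_iUnion_feasible hN ha0 hΦ
  have hopen := isOpen_regularSet ha hb ha0
  obtain ⟨ρ, hρlim, hρ⟩ := exists_seq_forall_of_frequently (hfreq.and_eventually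
    ((eventually_mem_nhdsWithin (s := Ioi (0 : ℝ))).and
      ((tendsto_add_smul_nhdsGT x d).eventually (hopen.mem_nhds hx))))
  obtain ⟨z, -, φ, hφ, hz⟩ := tendsto_subseq_of_bounded (x := fun k => zs (x + ρ k • d))
    (Metric.isBounded_closedBall (x := (0 : DecVar l)) (r := R))
    fun k => mem_closedBall_zero_iff.2 (hR _ _ (hzs _ (hρ k).2.2).1)
  set τ := ρ ∘ φ with hτ
  have hτlim : Tendsto τ atTop (𝓝[>] 0) := hρlim.comp hφ.tendsto_atTop
  have hτpos : ∀ k, 0 < τ k := fun k => (hρ (φ k)).2.1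
  have hτreg : ∀ k, x + τ k • d ∈ regularSet a b := fun k => (hρ (φ k)).2.2
  have hτquot : ∀ k, t < (hr a b ε₀ (x + τ k • d) - hr a b ε₀ x) / τ k :=
    fun k => (hρ (φ k)).1
  set ζ : ℕ → DecVar l := fun k => zs (x + τ k • d) with hζ
  replace hz : Tendsto ζ atTop (𝓝 z) := hz
  have hζsol : ∀ k, ζ k ∈ solutions a b (x + τ k • d) := fun k => hzs _ (hτreg k)
  have hxlim : Tendsto (fun k => x + τ k • d) atTop (𝓝 x) :=
    (tendsto_add_smul_nhdsGT x d).comp hτlim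
  have hzfeas : z ∈ feasible a b x :=
    mem_feasible_of_tendsto ha hb ha0 hxlim hz (Eventually.of_forall fun k => (hζsol k).1)
  -- Continuity of the value makes the limit point optimal.
  have hval : z.2 = (zs x).2 := by
    have hcont : ContinuousAt (hr a b ε₀) x :=
      (locallyLipschitzOn_hr hN ha hb ha0 hΦ ε₀ hzs).continuousOn.continuousAt
        (hopen.mem_nhds hx)
    have h1 : Tendsto (fun k => (ζ k).2 - ε₀) atTop (𝓝 (z.2 - ε₀)) :=
      ((continuous_snd.tendsto z).comp hz).sub_const ε₀
    have h2 : Tendsto (fun k => hr a b ε₀ (x + τ k • d)) atTop (𝓝 (hr a b ε₀ x)) :=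
      hcont.tendsto.comp hxlim
    simp only [fun k => hr_eq_of_mem_solutions (ε₀ := ε₀) (hζsol k),
      hr_eq_of_mem_solutions (ε₀ := ε₀) (hzs x hx)] at h2
    linarith [tendsto_nhds_unique h1 h2]
  have hzsol : z ∈ solutions a b x := by
    refine ⟨hzfeas, fun w hw => ?_⟩
    have := snd_le_of_mem_solutions (hzs x hx) hw
    rw [dot_q, dot_q]
    linarith
  obtain ⟨v, hv⟩ := exists_inward_direction ha0 hx z
  -- Small enough that adding `δ • v`, which makes the constraints strict, costs less than `t - s`
  -- in the objective.
  set δ := (t - s) / (|v.2| + 1) with hδ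
  have hδpos : 0 < δ := div_pos (sub_pos.2 hst) (by positivity)
  have hδv : -(t - s) < δ * v.2 := by
    have h1 : δ * (|v.2| + 1) = t - s := div_mul_cancel₀ _ (by positivity)
    nlinarith [neg_abs_le v.2]
  -- Subtracting the equality at `(z, x)` from feasibility of `ζ k` bounds the row by quotients of
  -- the data alone; the quotients of `ζ` need not converge.
  have hrows : ∀ j ∈ active a b z x, ∀ᶠ k in atTop,
      dot (aTilde a j x) ((τ k)⁻¹ • (ζ k - z)) <
        linearizedRhs a b z x d j - δ * dot (aTilde a j x) v := fun j hj => by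
    have hA := (hasLineDerivAt_aTilde ha ha0 j x d).tendsto_slope_zero_right.comp hτlim
    have hB := (hasLineDerivAt_bTilde hb j x d).tendsto_slope_zero_right.comp hτlim
    have hlim := hB.sub (tendsto_dot hz hA)
    have hgt : linearizedRhs a b z x d j <
        linearizedRhs a b z x d j - δ * dot (aTilde a j x) v := by
      have := mul_neg_of_pos_of_neg hδpos (hv j hj)
      linarith
    filter_upwards [hlim.eventually (gt_mem_nhds hgt)] with k hk
    refine lt_of_le_of_lt ?_ hk
    simp only [Function.comp_apply, smul_eq_mul]
    have h1 := (hζsol k).1 j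
    rw [dot_smul, dot_smul, ← mul_sub, dot_sub, dot_sub, dot_comm (ζ k), dot_comm (ζ k),
      mem_active_iff.1 hj]
    refine mul_le_mul_of_nonneg_left ?_ (inv_nonneg.2 (hτpos k).le)
    linarith
  obtain ⟨k, hk⟩ := ((Finset.eventually_all (active a b z x)).2 hrows).exists
  refine ⟨z, hzsol, (τ k)⁻¹ • (ζ k - z) + δ • v, fun j hj => ?_, ?_⟩
  · rw [dot_add, dot_smul _ _ v]
    linarith [hk j hj]
  · have h1 := hτquot k
    rw [hr_eq_of_mem_solutions (hζsol k), hr_eq_of_mem_solutions hzsol, div_eq_inv_mul] at h1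
    simp only [Prod.snd_add, Prod.smul_snd, Prod.snd_sub, smul_eq_mul]
    have h2 : (ζ k).2 - ε₀ - (z.2 - ε₀) = (ζ k).2 - z.2 := by ring
    rw [h2] at h1
    linarith

theorem _root_.LocallyLipschitzOn.eventually_abs_slope_le {X : Type*} [NormedAddCommGroup X]
    [NormedSpace ℝ X] {h : X → ℝ} {A : Set X} (hh : LocallyLipschitzOn A h) (hA : IsOpen A)
    {x : X} (hx : x ∈ A) (d : X) :
    ∃ C : ℝ, ∀ᶠ σ : ℝ in 𝓝[>] 0, |(h (x + σ • d) - h x) / σ| ≤ C := by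
  obtain ⟨K, t, ht, hK⟩ := hh hx
  rw [hA.nhdsWithin_eq hx] at ht
  have hcont : Continuous fun σ : ℝ => x + σ • d := by fun_prop
  have hlim : Tendsto (fun σ : ℝ => x + σ • d) (𝓝[>] 0) (𝓝 x) := by
    simpa using (hcont.tendsto 0).mono_left (nhdsWithin_le_nhds (s := Ioi 0))
  refine ⟨K * ‖d‖, ?_⟩
  filter_upwards [hlim.eventually ht, self_mem_nhdsWithin] with σ hσ hσ0
  have h1 := hK.dist_le_mul _ hσ _ (mem_of_mem_nhds ht)
  rw [Real.dist_eq, dist_self_add_left, norm_smul, Real.norm_of_nonneg (le_of_lt hσ0)] at h1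
  rw [abs_div, abs_of_pos (mem_Ioi.1 hσ0), div_le_iff₀ hσ0]
  linarith

/-- The quotients are bounded by the Lipschitz property, and an upcrossing of `s < t` would give a
direction that keeps them eventually above `s`. -/
theorem dirDifferentiableOn_hr (hN : 0 < N) (ha : ∀ j, ContDiff ℝ 1 (a j))
    (hb : ∀ j, ContDiff ℝ 1 (b j)) (ha0 : ∀ j x, a j x ≠ 0)
    (hΦ : ∃ Dy : Set (EuclideanSpace ℝ (Fin l)), IsCompact Dy ∧ ∀ x, polytope a b x ⊆ Dy)
    (ε₀ : ℝ) {zs : EuclideanSpace ℝ (Fin n) → DecVar l}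
    (hzs : ∀ x ∈ regularSet a b, zs x ∈ solutions a b x) :
    DirDifferentiableOn (hr a b ε₀) (regularSet a b) := by
  intro x hx d
  obtain ⟨C, hC⟩ := (locallyLipschitzOn_hr hN ha hb ha0 hΦ ε₀ hzs).eventually_abs_slope_le
    (isOpen_regularSet ha hb ha0) hx d
  refine tendsto_of_no_upcrossings dense_univ ?_
    ⟨C, eventually_map.2 (hC.mono fun σ hσ => (abs_le.1 hσ).2)⟩
    ⟨-C, eventually_map.2 (hC.mono fun σ hσ => (abs_le.1 hσ).1)⟩
  rintro s - t - hst ⟨hlow, hup⟩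
  obtain ⟨z, hz, w, hw, hsw⟩ :=
    exists_direction_of_frequently hN ha hb ha0 hΦ hzs hx hst hup
  obtain ⟨σ, hσ, hσ'⟩ :=
    (hlow.and_eventually (eventually_le_slope_hr ha hb ha0 ε₀ hzs hx hz hw)).exists
  linarith

/-- Lower bounds on the derivative of the Lagrangian over the multipliers of one solution are lower
bounds on the directional derivative of the value. -/
theorem le_of_hasDirDerivAt_hr (ha : ∀ j, ContDiff ℝ 1 (a j))
    (hb : ∀ j, ContDiff ℝ 1 (b j)) (ha0 : ∀ j x, a j x ≠ 0)
    {ε₀ : ℝ} {zs : EuclideanSpace ℝ (Fin n) → DecVar l}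
    (hzs : ∀ x ∈ regularSet a b, zs x ∈ solutions a b x) {x d : EuclideanSpace ℝ (Fin n)}
    (hx : x ∈ regularSet a b) {z : DecVar l} (hz : z ∈ solutions a b x) {L D : ℝ}
    (hL : ∀ μ ∈ multipliers a b z x, L ≤ -dxL a b z x μ d)
    (hD : HasDirDerivAt (hr a b ε₀) D x d) : L ≤ D := by
  refine le_of_forall_lt fun L' hL' => ?_
  obtain ⟨v, hv⟩ := exists_inward_direction ha0 hx z
  -- Duality for the linearised program; the slack `L' < L` is what allows strict constraints.
  obtain ⟨w, hw, hlt⟩ := exists_strict_direction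
    (fun j : active a b z x => aTilde a (j : Fin (N + 1)) x)
    (fun j => linearizedRhs a b z x d j) (fun j => hv j j.2) hL'
    (fun μ hμ0 hμ => (hL μ ⟨hμ0, hμ⟩).trans_eq (neg_dxL_eq z x d μ))
  exact hlt.trans_le <| ge_of_tendsto hD
    (eventually_le_slope_hr ha hb ha0 ε₀ hzs hx hz fun j hj => hw ⟨j, hj⟩)

/-- A limit of solutions keeps radius at least `ε₀ > 0`, so the limit state cannot leave
`regularSet`. -/
theorem isClosed_superlevel_zero (hN : 0 < N) (ha : ∀ j, ContDiff ℝ 1 (a j))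
    (hb : ∀ j, ContDiff ℝ 1 (b j)) (ha0 : ∀ j x, a j x ≠ 0)
    (hΦ : ∃ Dy : Set (EuclideanSpace ℝ (Fin l)), IsCompact Dy ∧ ∀ x, polytope a b x ⊆ Dy)
    {ε₀ : ℝ} (hε₀ : 0 < ε₀) {zs : EuclideanSpace ℝ (Fin n) → DecVar l}
    (hzs : ∀ x ∈ regularSet a b, zs x ∈ solutions a b x) :
    IsClosed (superlevel a b ε₀ 0) := by
  obtain ⟨R, -, hR⟩ := isBounded_iUnion_feasible hN ha0 hΦ
  refine IsSeqClosed.isClosed fun y x hy hyx => ?_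
  obtain ⟨z, -, φ, hφ, hz⟩ := tendsto_subseq_of_bounded (x := fun k => zs (y k))
    (Metric.isBounded_closedBall (x := (0 : DecVar l)) (r := R))
    fun k => mem_closedBall_zero_iff.2 (hR _ _ (hzs _ (hy k).1).1)
  have hzfeas : z ∈ feasible a b x :=
    mem_feasible_of_tendsto ha hb ha0 (hyx.comp hφ.tendsto_atTop) hz
      (Eventually.of_forall fun k => (hzs _ (hy (φ k)).1).1)
  have hz2 : ε₀ ≤ z.2 := ge_of_tendsto' ((continuous_snd.tendsto z).comp hz) fun k => by
    have := (hy (φ k)).2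
    rw [hr_eq_of_mem_solutions (hzs _ (hy (φ k)).1)] at this
    exact sub_nonneg.1 this
  have hx := mem_regularSet_of_mem_feasible ha0 hzfeas (hε₀.trans_le hz2)
  refine ⟨hx, ?_⟩
  rw [hr_eq_of_mem_solutions (hzs x hx)]
  linarith [snd_le_of_mem_solutions (hzs x hx) hzfeas]

end Value

end PVM

/-! ### The barrier property. -/

theorem theorem2 {n m l N K : ℕ} (hN : 0 < N)
    -- the control-affine dynamics
    (f : EuclideanSpace ℝ (Fin n) → EuclideanSpace ℝ (Fin n))
    (g : EuclideanSpace ℝ (Fin n) → EuclideanSpace ℝ (Fin m) →L[ℝ] EuclideanSpace ℝ (Fin n))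
    (hf : LocallyLipschitz f) (hg : LocallyLipschitz g)
    -- the data of the output polytope and of the input polytope
    (a : Fin N → EuclideanSpace ℝ (Fin n) → EuclideanSpace ℝ (Fin l))
    (b : Fin N → EuclideanSpace ℝ (Fin n) → ℝ)
    (a' : Fin K → EuclideanSpace ℝ (Fin n) → EuclideanSpace ℝ (Fin m))
    (b' : Fin K → EuclideanSpace ℝ (Fin n) → ℝ)
    (ha : ∀ j, ContDiff ℝ 1 (a j)) (hb : ∀ j, ContDiff ℝ 1 (b j))
    (ha' : ∀ i, ContDiff ℝ 1 (a' i)) (hb' : ∀ i, ContDiff ℝ 1 (b' i))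
    -- the standing assumption
    (hΨ : ∀ x, (PVM.polytope a' b' x).Nonempty)
    (ha0 : ∀ j x, a j x ≠ 0)
    (hΦ : ∃ Dy : Set (EuclideanSpace ℝ (Fin l)), IsCompact Dy ∧ ∀ x, PVM.polytope a b x ⊆ Dy)
    (ε₀ : ℝ) (hε₀ : 0 < ε₀)
    -- an arbitrary selection of the solution map
    (zs : EuclideanSpace ℝ (Fin n) → PVM.DecVar l)
    (hzs : ∀ x ∈ PVM.regularSet a b, zs x ∈ PVM.solutions a b x)
    -- the sufficient condition
    (hcond : ∃ α : ℝ, 0 < α ∧ ∃ ε : ℝ, 0 < ε ∧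
      ∀ x ∈ PVM.superlevel a b ε₀ (-ε), ∃ u ∈ PVM.polytope a' b' x,
        ((-(α * PVM.hr a b ε₀ x) : ℝ) : EReal) ≤
          ⨅ μ ∈ PVM.multipliers a b (zs x) x,
            ((-PVM.dxL a b (zs x) x μ (f x + g x u) : ℝ) : EReal)) :
    LocallyLipschitzOn (PVM.regularSet a b) (PVM.hr a b ε₀) ∧
    PVM.DirDifferentiableOn (PVM.hr a b ε₀) (PVM.regularSet a b) ∧
    IsClosed (PVM.superlevel a b ε₀ 0) ∧
    (∀ x ∈ frontier (PVM.superlevel a b ε₀ 0), PVM.hr a b ε₀ x = 0) ∧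
    PVM.NCBFCondition (fun x u => f x + g x u) (PVM.polytope a' b') (PVM.regularSet a b)
      (PVM.hr a b ε₀) (PVM.superlevel a b ε₀ 0) ∧
    ((PVM.superlevel a b ε₀ 0).Nonempty → Preperfect (PVM.superlevel a b ε₀ 0) →
      (∀ x ∈ interior (PVM.superlevel a b ε₀ 0), 0 < PVM.hr a b ε₀ x) →
      PVM.IsNCBF (fun x u => f x + g x u) (PVM.polytope a' b') (PVM.regularSet a b)
        (PVM.hr a b ε₀) (PVM.superlevel a b ε₀ 0)) := by
  obtain ⟨α, hα, ε, hε, hcond⟩ := hcond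
  have hopen := PVM.isOpen_regularSet ha hb ha0
  have hlip := PVM.locallyLipschitzOn_hr hN ha hb ha0 hΦ ε₀ hzs
  have hdir := PVM.dirDifferentiableOn_hr hN ha hb ha0 hΦ ε₀ hzs
  have hclosed := PVM.isClosed_superlevel_zero hN ha hb ha0 hΦ hε₀ hzs
  have hfr : ∀ x ∈ frontier (PVM.superlevel a b ε₀ 0), PVM.hr a b ε₀ x = 0 := by
    intro x hx
    have hxS := hclosed.frontier_subset hx
    refine le_antisymm (not_lt.1 fun hpos => hx.2 ?_) hxS.2
    refine mem_interior.2 ⟨PVM.regularSet a b ∩ PVM.hr a b ε₀ ⁻¹' Ioi 0,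
      fun y hy => ⟨hy.1, le_of_lt hy.2⟩,
      hlip.continuousOn.isOpen_inter_preimage hopen isOpen_Ioi, hxS.1, hpos⟩
  have hncbf : PVM.NCBFCondition (fun x u => f x + g x u) (PVM.polytope a' b')
      (PVM.regularSet a b) (PVM.hr a b ε₀) (PVM.superlevel a b ε₀ 0) := by
    -- `D` is the strict superlevel set at `-ε`, open since the value is continuous on the open
    -- `regularSet`.
    refine ⟨fun r => α * r, ⟨continuous_const.mul continuous_id,
      strictMono_mul_left_of_pos hα, mul_zero α⟩,
      PVM.regularSet a b ∩ PVM.hr a b ε₀ ⁻¹' Ioi (-ε),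
      hlip.continuousOn.isOpen_inter_preimage hopen isOpen_Ioi,
      fun x hx => ⟨hx.1, lt_of_lt_of_le (neg_lt_zero.2 hε) hx.2⟩, inter_subset_left, ?_⟩
    intro x hx
    obtain ⟨u, hu, hle⟩ := hcond x ⟨hx.1, le_of_lt hx.2⟩
    obtain ⟨L, hL⟩ := hdir x hx.1 (f x + g x u)
    refine le_trans ?_ (le_iSup₂ (f := fun u _ =>
      ((PVM.dirDeriv (PVM.hr a b ε₀) x (f x + g x u) : ℝ) : EReal)) u hu)
    rw [EReal.coe_le_coe_iff, PVM.dirDeriv, hL.limUnder_eq]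
    exact PVM.le_of_hasDirDerivAt_hr ha hb ha0 hzs hx.1 (hzs x hx.1)
      (fun μ hμ => EReal.coe_le_coe_iff.1 (le_iInf₂_iff.1 hle μ hμ)) hL
  refine ⟨hlip, hdir, hclosed, hfr, hncbf, fun hne hperf hpos => ⟨⟨hne, hclosed, hperf,
    fun x hx => hx.1, hlip, hfr, hpos, fun x hx => ?_⟩, hdir, hncbf⟩⟩
  exact not_le.1 fun h => hx.2 ⟨hx.1, h⟩
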